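/- **Corollary 5.1.** Fix $m\ge 1$, $\alpha\in(0,1)$ and $\rho_1,\dots,\rho_m\in(0,1)$. For each $n$ let the index set $\mathcal I=\{1,\dots,n\}$ be partitioned into blocks $\mathcal I_1,\dots,\mathcal I_m$ of sizes $k_j=k_j(n)$, and let $(X_1,\dots,X_n)$ be jointly Gaussian with means $\mu_i=\mu_i(n)\ge 0$ and covariance matrix $R_n$ whose diagonal entries are $1$, whose entries at distinct $i,i'\in\mathcal I_j$ equal $\rho_j$, and whose entries at $i,i'$ in different blocks are arbitrary nonnegative numbers (which may depend on $n$). Test $H_{0i}:\mu_i=0$ against $H_{1i}:\mu_i>0$ for $i\in\mathcal I$. Let $\Phi$ be the standard normal distribution function, put $\beta=1-(1-\alpha)^{1/m}$, and consider the procedure that, for each $j$ and each $i\in\mathcal I_j$, rejects $H_{0i}$ when $$X_i>\sqrt{1-\rho_j}\,\Phi^{-1}\!\left(1-\tfrac1{k_j}\right)-\sqrt{\rho_j}\,\Phi^{-1}(\beta).$$ Let $\mathrm{FWER}(n,\alpha,R_n)$ be the probability that at least one $H_{0i}$ with $\mu_i=0$ is rejected, and let $k_{j0}=k_{j0}(n)=|\{i\in\mathcal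 I_j:\mu_i=0\}|$. Suppose $\min_j k_j\to\infty$ as $n\to\infty$ and that, for every $j$, the limit $\lim_{n\to\infty}k_{j0}/k_j$ exists and is positive. Then $$\limsup_{n\to\infty}\mathrm{FWER}(n,\alpha,R_n)\le\alpha .$$ In particular, if $\mathrm{FWER}(n,\alpha,R_n)$ converges, its limit is at most $\alpha$. -/

import Mathlib

open MeasureTheory ProbabilityTheory Filter Topology

namespace BlockFWER

noncomputable section

/-- The quantile function `Φ⁻¹` of the standard normal distribution,
`Φ⁻¹(p) = inf {x : p ≤ Φ(x)}`, for `p` in `(0,1)`. -/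
def stdNormalQuantile (p : ℝ) : ℝ :=
  sInf {x : ℝ | p ≤ cdf (gaussianReal 0 1) x}

/-- The common cutoff `√(1 - ρ) Φ⁻¹(1 - 1/k) - √ρ Φ⁻¹(a)` for `k` observations with
common correlation `ρ` at level `a`. -/
def cutoff (k : ℕ) (ρ a : ℝ) : ℝ :=
  √(1 - ρ) * stdNormalQuantile (1 - 1 / (k : ℝ)) - √ρ * stdNormalQuantile a

/-- Indices of the `j`-th block; `b i` is the block to which the index `i` belongs. -/
def block {n m : ℕ} (b : Fin n → Fin m) (j : Fin m) : Finset (Fin n) :=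
  Finset.univ.filter fun i => b i = j

/-- Indices of the true null hypotheses `μ i = 0`. -/
def trueNulls {n : ℕ} (μ : Fin n → ℝ) : Finset (Fin n) :=
  Finset.univ.filter fun i => μ i = 0

/-- The number `k_j` of indices in block `j`. -/
def blockSize {n m : ℕ} (b : Fin n → Fin m) (j : Fin m) : ℕ :=
  (block b j).card

/-- The number `k_{j0}` of true nulls in block `j`. -/
def blockNullSize {n m : ℕ} (b : Fin n → Fin m) (μ : Fin n → ℝ) (j : Fin m) : ℕ :=
  (block b j ∩ trueNulls μ).card

/-- `R` has unit diagonal, constant correlation `ρ j` inside block `j`, and arbitrary nonnegative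
entries between different blocks. -/
structure IsBlockCorrelation {n m : ℕ} (b : Fin n → Fin m) (ρ : Fin m → ℝ)
    (R : Matrix (Fin n) (Fin n) ℝ) : Prop where
  diag : ∀ i, R i i = 1
  within : ∀ i i', i ≠ i' → b i = b i' → R i i' = ρ (b i)
  between : ∀ i i', b i ≠ b i' → 0 ≤ R i i'

/-- `X 0, …, X (n-1)` are jointly Gaussian with mean vector `μ` and covariance matrix `R`. -/
structure IsGaussianVector {Ω : Type*} [MeasurableSpace Ω] (P : Measure Ω) {n : ℕ}
    (X : Fin n → Ω → ℝ) (μ : Fin n → ℝ) (R : Matrix (Fin n) (Fin n) ℝ) : Prop where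
  gaussian : HasGaussianLaw (fun ω i => X i ω) P
  mean : ∀ i, ∫ ω, X i ω ∂P = μ i
  covariance : ∀ i i', cov[X i, X i'; P] = R i i'

/-- The single-step block procedure: with `β = 1 - (1 - α)^(1/m)`, hypothesis `i` of block `j` is
rejected when `x i` exceeds the cutoff for `k_j` observations with correlation `ρ j` at level `β`.
The value is the set of rejected hypotheses. -/
def blockProcedure {n m : ℕ} (α : ℝ) (b : Fin n → Fin m) (ρ : Fin m → ℝ) (x : Fin n → ℝ) :
    Finset (Fin n) :=
  Finset.univ.filter fun i =>
    cutoff (blockSize b (b i)) (ρ (b i)) (1 - (1 - α) ^ (1 / (m : ℝ))) < x i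

/-- The number of false rejections of the procedure `T` at the data `x`. -/
def falseRejections {n : ℕ} (T : (Fin n → ℝ) → Finset (Fin n)) (μ x : Fin n → ℝ) : ℕ :=
  (T x ∩ trueNulls μ).card

/-- The family-wise error rate of the procedure `T`: the probability of at least one false
rejection. -/
def fwer {Ω : Type*} [MeasurableSpace Ω] (P : Measure Ω) {n : ℕ} (X : Fin n → Ω → ℝ)
    (μ : Fin n → ℝ) (T : (Fin n → ℝ) → Finset (Fin n)) : ℝ :=
  P.real {ω | 1 ≤ falseRejections T μ (fun i => X i ω)}

end

end BlockFWER

/-! No true null is rejected exactly when the null coordinates, which are centered, all stay below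
their cutoffs. Slepian's inequality (`measureReal_forall_le_mono`) says that replacing the
nonnegative between-block covariances by zero can only lower this probability. The comparison vector
has the one-factor form `√ρ_j Z_j + √(1 - ρ_j) Z_i` with independent standard normal factors.

In that model, let each block factor stay below `-Φ⁻¹(β) - ε`. The slack `ε` raises the threshold
for the individual factors from `Φ⁻¹(1 - 1/k_j)` by a fixed positive amount. Gaussian tails are so
thin that the expected number of exceedances then drops from 1 to `o(1)`
(`tendsto_mul_one_sub_cdf_quantile_add`). Only the block factors remain in the limit, so the limsup
is at most `1 - Φ(-Φ⁻¹(β) - ε)^m`. As `ε → 0` this tends to `1 - (1 - β)^m = α`. -/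

namespace BlockFWER

/-! ### Gaussian interpolation: Slepian's inequality for smooth functions -/

section Slepian

variable {Ω : Type*} {mΩ : MeasurableSpace Ω} {P : Measure Ω} {ι : Type*} [Fintype ι]

/-- A centered Gaussian variable that is nonnegatively correlated with a jointly Gaussian vector
`V` has nonnegative correlation with every bounded function of `V` that is monotone in the
coordinates correlated with it. -/
lemma integral_mul_nonneg_of_covariance_nonneg {W : Ω → ℝ} {V : ι → Ω → ℝ}
    (hWV : HasGaussianLaw (fun ω => (W ω, fun j => V j ω)) P) (hW0 : ∫ ω, W ω ∂P = 0)
    (hvar : 0 < cov[W, W; P]) (hcov : ∀ j, 0 ≤ cov[W, V j; P]) {h : (ι → ℝ) → ℝ}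
    (hh : Measurable h) {C : ℝ} (hC : ∀ x, |h x| ≤ C)
    (hmono : ∀ x y, x ≤ y → (∀ j, cov[W, V j; P] = 0 → x j = y j) → h x ≤ h y) :
    0 ≤ ∫ ω, W ω * h (fun j => V j ω) ∂P := by
  have := hWV.isProbabilityMeasure
  have hW := hWV.fst
  have hV := hWV.snd
  -- Regression coefficients of `V` on `W`: the residual `V - W a` is uncorrelated with `W`, hence
  -- independent of it by joint Gaussianity.
  set a : ι → ℝ := fun j => cov[W, V j; P] / cov[W, W; P] with ha
  have ha0 : ∀ j, 0 ≤ a j := fun j => div_nonneg (hcov j) hvar.le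
  let L : ℝ × (ι → ℝ) →L[ℝ] (Unit → ℝ) × (ι → ℝ) :=
    (ContinuousLinearMap.pi fun _ => ContinuousLinearMap.fst ℝ ℝ (ι → ℝ)).prod
      (ContinuousLinearMap.snd ℝ ℝ (ι → ℝ) - (ContinuousLinearMap.fst ℝ ℝ (ι → ℝ)).smulRight a)
  have hU : HasGaussianLaw
      (fun ω => ((fun _ : Unit => W ω), fun j => V j ω - W ω * a j)) P := by
    have := hWV.map_fun L
    exact this
  have hind : IndepFun (fun ω (_ : Unit) => W ω) (fun ω j => V j ω - W ω * a j) P := by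
    refine HasGaussianLaw.indepFun_of_covariance_eval (X := fun _ => W)
      (Y := fun j ω => V j ω - W ω * a j) hU fun _ j => ?_
    have h1 : MemLp W 2 P := hW.memLp_two
    have h2 : MemLp (V j) 2 P := (hV.eval j).memLp_two
    rw [covariance_fun_sub_right h1 h2 (h1.mul_const _), covariance_mul_const_right]
    simp only [ha]
    field_simp
    ring
  have hint : ∀ {g : Ω → (ι → ℝ)}, AEMeasurable g P → Integrable (fun ω => W ω * h (g ω)) P := by
    intro g hg
    refine hW.integrable.mul_bdd (c := C) (hh.comp_aemeasurable hg).aestronglyMeasurable ?_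
    exact ae_of_all _ fun ω => hC _
  have hUm : AEMeasurable (fun ω j => V j ω - W ω * a j) P := hU.snd.aemeasurable
  have hzero : ∫ ω, W ω * h (fun j => V j ω - W ω * a j) ∂P = 0 := by
    have hi := hind.comp (φ := fun w : Unit → ℝ => w ()) (ψ := h)
      (measurable_pi_apply (X := fun _ : Unit => ℝ) ()) hh
    have := hi.integral_mul_eq_mul_integral hW.aemeasurable.aestronglyMeasurable
      (hh.comp_aemeasurable hUm).aestronglyMeasurable
    simp only [Function.comp_def, Pi.mul_def, hW0, zero_mul] at this
    exact this
  rw [← hzero]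
  refine integral_mono (hint hUm) (hint hV.aemeasurable) fun ω => ?_
  have hz : ∀ j, cov[W, V j; P] = 0 → V j ω - W ω * a j = V j ω := by
    intro j hj; simp [ha, hj]
  -- Going from the residual to `V` moves the coordinates in the direction of the sign of `W`, so `W
  -- * h` grows in both cases.
  rcases le_total 0 (W ω) with hw | hw
  · refine mul_le_mul_of_nonneg_left (hmono _ _ (fun j => ?_) fun j hj => hz j hj) hw
    have := mul_nonneg hw (ha0 j)
    simp only; linarith
  · refine mul_le_mul_of_nonpos_left (hmono _ _ (fun j => ?_) fun j hj => (hz j hj).symm) hw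
    have := mul_nonpos_of_nonpos_of_nonneg hw (ha0 j)
    simp only; linarith

/-- **Slepian's inequality** for products of smooth antitone functions, by interpolating along
`sin θ X + cos θ Y`. -/
lemma integral_prod_antitone_le {X Y : ι → Ω → ℝ}
    (hXY : HasGaussianLaw (fun ω => (fun i => X i ω, fun i => Y i ω)) P)
    (hind : ∀ i j, cov[X i, Y j; P] = 0)
    (hX0 : ∀ i, ∫ ω, X i ω ∂P = 0) (hY0 : ∀ i, ∫ ω, Y i ω ∂P = 0)
    (hpos : ∀ i, 0 < cov[Y i, Y i; P]) (hdiag : ∀ i, cov[Y i, Y i; P] = cov[X i, X i; P])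
    (hle : ∀ i j, cov[Y i, Y j; P] ≤ cov[X i, X j; P])
    {φ φ' : ι → ℝ → ℝ} (hφ : ∀ i x, HasDerivAt (φ i) (φ' i x) x)
    (h0 : ∀ i x, 0 ≤ φ i x) (h1 : ∀ i x, φ i x ≤ 1) (hneg : ∀ i x, φ' i x ≤ 0)
    (hcont : ∀ i, Continuous (φ' i)) {C : ℝ} (hC : ∀ i x, |φ' i x| ≤ C) :
    ∫ ω, ∏ i, φ i (Y i ω) ∂P ≤ ∫ ω, ∏ i, φ i (X i ω) ∂P := by
  classical
  have := hXY.isProbabilityMeasure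
  have hX := hXY.fst
  have hY := hXY.snd
  have hXi : ∀ i, HasGaussianLaw (X i) P := hX.eval
  have hYi : ∀ i, HasGaussianLaw (Y i) P := hY.eval
  have hXm : ∀ i, AEMeasurable (X i) P := fun i => (hXi i).aemeasurable
  have hYm : ∀ i, AEMeasurable (Y i) P := fun i => (hYi i).aemeasurable
  have hφc : ∀ i, Continuous (φ i) := fun i =>
    continuous_iff_continuousAt.2 fun x => (hφ i x).continuousAt
  have hanti : ∀ i, Antitone (φ i) := fun i =>
    antitone_of_hasDerivAt_nonpos (fun x => hφ i x) fun x => hneg i x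
  -- The path runs from `Y` at `θ = 0` to `X` at `θ = π / 2`, and `W` is its derivative in `θ`.
  let V : ℝ → ι → Ω → ℝ := fun θ i ω => Real.sin θ * X i ω + Real.cos θ * Y i ω
  let W : ℝ → ι → Ω → ℝ := fun θ i ω => Real.cos θ * X i ω - Real.sin θ * Y i ω
  have hprod1 : ∀ (s : Finset ι) (x : ι → ℝ), |∏ i ∈ s, φ i (x i)| ≤ 1 := fun s x => by
    rw [abs_of_nonneg (Finset.prod_nonneg fun i _ => h0 i _)]
    exact Finset.prod_le_one (fun i _ => h0 i _) fun i _ => h1 i _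
  let F' : ℝ → Ω → ℝ := fun θ ω =>
    ∑ i, (∏ j ∈ Finset.univ.erase i, φ j (V θ j ω)) * (φ' i (V θ i ω) * W θ i ω)
  have hderiv : ∀ θ, Integrable (F' θ) P ∧
      HasDerivAt (fun θ => ∫ ω, ∏ i, φ i (V θ i ω) ∂P) (∫ ω, F' θ ω ∂P) θ := by
    intro θ
    refine hasDerivAt_integral_of_dominated_loc_of_deriv_le (s := Set.univ) univ_mem
      (bound := fun ω => ∑ i, C * (|X i ω| + |Y i ω|)) ?_ ?_ ?_ ?_ ?_ ?_
    · refine Eventually.of_forall fun θ => AEMeasurable.aestronglyMeasurable ?_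
      refine Finset.aemeasurable_fun_prod _ fun i _ => (hφc i).measurable.comp_aemeasurable ?_
      exact ((hXm i).const_mul _).add ((hYm i).const_mul _)
    · refine Integrable.of_bound (C := 1) (AEMeasurable.aestronglyMeasurable ?_)
        (ae_of_all _ fun ω => hprod1 _ _)
      refine Finset.aemeasurable_fun_prod _ fun i _ => (hφc i).measurable.comp_aemeasurable ?_
      exact ((hXm i).const_mul _).add ((hYm i).const_mul _)
    · refine AEMeasurable.aestronglyMeasurable ?_
      refine Finset.aemeasurable_fun_sum _ fun i _ => ?_
      refine (Finset.aemeasurable_fun_prod _ fun j _ =>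
        (hφc j).measurable.comp_aemeasurable ?_).mul
        (((hcont i).measurable.comp_aemeasurable ?_).mul ?_)
      · exact ((hXm j).const_mul _).add ((hYm j).const_mul _)
      · exact ((hXm i).const_mul _).add ((hYm i).const_mul _)
      · exact ((hXm i).const_mul _).sub ((hYm i).const_mul _)
    · refine ae_of_all _ fun ω θ _ => ?_
      rw [Real.norm_eq_abs]
      refine (Finset.abs_sum_le_sum_abs _ _).trans (Finset.sum_le_sum fun i _ => ?_)
      rw [abs_mul, abs_mul, ← one_mul (C * _)]
      have hC0 : 0 ≤ C := (abs_nonneg _).trans (hC i 0)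
      have hW : |W θ i ω| ≤ |X i ω| + |Y i ω| := by
        refine (abs_sub _ _).trans ?_
        rw [abs_mul, abs_mul]
        have e1 := mul_le_mul_of_nonneg_right (Real.abs_cos_le_one θ) (abs_nonneg (X i ω))
        have e2 := mul_le_mul_of_nonneg_right (Real.abs_sin_le_one θ) (abs_nonneg (Y i ω))
        linarith
      refine mul_le_mul (hprod1 _ _) ?_ (by positivity) zero_le_one
      exact mul_le_mul (hC i _) hW (abs_nonneg _) hC0
    · exact integrable_finsetSum _ fun i _ =>
        (((hXi i).integrable.abs).add ((hYi i).integrable.abs)).const_mul C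
    · refine ae_of_all _ fun ω θ _ => ?_
      have hV : ∀ i, HasDerivAt (fun θ => φ i (V θ i ω)) (φ' i (V θ i ω) * W θ i ω) θ := by
        intro i
        refine (hφ i _).comp θ ?_
        have := ((Real.hasDerivAt_sin θ).mul_const (X i ω)).add
          ((Real.hasDerivAt_cos θ).mul_const (Y i ω))
        convert! this using 1
        simp only [W]; ring
      simpa [F'] using HasDerivAt.fun_finsetProd (u := Finset.univ) fun i _ => hV i
  have hcovWV : ∀ θ i j, cov[W θ i, V θ j; P]
      = Real.sin θ * Real.cos θ * (cov[X i, X j; P] - cov[Y i, Y j; P]) := by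
    intro θ i j
    have m1 := (hXi i).memLp_two.const_mul (Real.cos θ)
    have m2 := (hYi i).memLp_two.const_mul (Real.sin θ)
    have m3 := (hXi j).memLp_two.const_mul (Real.sin θ)
    have m4 := (hYi j).memLp_two.const_mul (Real.cos θ)
    have eV : V θ j = (fun ω => Real.sin θ * X j ω) + fun ω => Real.cos θ * Y j ω := rfl
    simp only [eV, W]
    rw [covariance_fun_sub_left m1 m2 (m3.add m4), covariance_add_right m1 m3 m4,
      covariance_add_right m2 m3 m4]
    simp only [covariance_const_mul_left, covariance_const_mul_right, hind,
      covariance_comm (Y i) (X j)]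
    ring
  have hcovWW : ∀ θ i, cov[W θ i, W θ i; P] = cov[Y i, Y i; P] := by
    intro θ i
    have m1 := (hXi i).memLp_two.const_mul (Real.cos θ)
    have m2 := (hYi i).memLp_two.const_mul (Real.sin θ)
    have m3 : MemLp (fun ω => Real.cos θ * X i ω - Real.sin θ * Y i ω) 2 P := m1.sub m2
    simp only [W]
    rw [covariance_fun_sub_left m1 m2 m3, covariance_fun_sub_right m1 m1 m2,
      covariance_fun_sub_right m2 m1 m2]
    simp only [covariance_const_mul_left, covariance_const_mul_right, hind,
      covariance_comm (Y i) (X i), ← hdiag]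
    linear_combination cov[Y i, Y i; P] * Real.sin_sq_add_cos_sq θ
  have hnonneg : ∀ θ ∈ Set.Ioo (0 : ℝ) (Real.pi / 2), 0 ≤ ∫ ω, F' θ ω ∂P := by
    intro θ hθ
    have hs : 0 < Real.sin θ := Real.sin_pos_of_pos_of_lt_pi hθ.1 (by linarith [hθ.2, Real.pi_pos])
    have hc : 0 < Real.cos θ := Real.cos_pos_of_mem_Ioo ⟨by linarith [hθ.1, Real.pi_pos], hθ.2⟩
    -- A nonpositive factor times a product of antitone ones: increasing in every coordinate but the
    -- `i`-th, where nothing is known about `φ' i`. Equal variances make `W θ i` uncorrelated with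
    -- `V θ i`, so that coordinate may be held fixed.
    let h : ι → (ι → ℝ) → ℝ := fun i x => φ' i (x i) * ∏ j ∈ Finset.univ.erase i, φ j (x j)
    have hhm : ∀ i, Measurable (h i) := fun i => by
      refine Continuous.measurable (Continuous.mul ((hcont i).comp (continuous_apply i)) ?_)
      exact continuous_finsetProd _ fun j _ => (hφc j).comp (continuous_apply j)
    have hhb : ∀ i x, |h i x| ≤ C := fun i x => by
      simp only [h]
      rw [abs_mul, ← mul_one C]
      exact mul_le_mul (hC i _) (hprod1 _ _) (abs_nonneg _) ((abs_nonneg _).trans (hC i 0))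
    have hF : ∀ ω, F' θ ω = ∑ i, W θ i ω * h i (fun j => V θ j ω) := fun ω =>
      Finset.sum_congr rfl fun i _ => by simp only [h]; ring
    have hGauss : ∀ i, HasGaussianLaw (fun ω => (W θ i ω, fun j => V θ j ω)) P := by
      intro i
      let fX := ContinuousLinearMap.fst ℝ (ι → ℝ) (ι → ℝ)
      let fY := ContinuousLinearMap.snd ℝ (ι → ℝ) (ι → ℝ)
      let L := ((ContinuousLinearMap.proj (R := ℝ) (φ := fun _ : ι => ℝ) i).comp
        (Real.cos θ • fX - Real.sin θ • fY)).prod (Real.sin θ • fX + Real.cos θ • fY)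
      exact hXY.map_fun L
    have hWint : ∀ i, Integrable (fun ω => W θ i ω * h i (fun j => V θ j ω)) P := fun i =>
      (hGauss i).fst.integrable.mul_bdd (c := C)
        ((hhm i).comp_aemeasurable (hGauss i).snd.aemeasurable).aestronglyMeasurable
        (ae_of_all _ fun ω => hhb i fun j => V θ j ω)
    simp_rw [hF]
    rw [integral_finsetSum _ fun i _ => hWint i]
    refine Finset.sum_nonneg fun i _ => ?_
    refine integral_mul_nonneg_of_covariance_nonneg (hGauss i) ?_ ?_ ?_ (hhm i) (hhb i) ?_
    · simp only [W]
      rw [integral_sub ((hXi i).integrable.const_mul _) ((hYi i).integrable.const_mul _),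
        integral_const_mul, integral_const_mul, hX0, hY0]
      simp
    · rw [hcovWW]; exact hpos i
    · intro j
      rw [hcovWV]
      exact mul_nonneg (mul_pos hs hc).le (sub_nonneg.2 (hle i j))
    · intro x y hxy hx
      have hi : x i = y i := hx i (by rw [hcovWV, hdiag, sub_self, mul_zero])
      simp only [h, hi]
      refine mul_le_mul_of_nonpos_left ?_ (hneg i _)
      exact Finset.prod_le_prod (fun j _ => h0 j _) fun j _ => hanti j (hxy j)
  have hmono : MonotoneOn (fun θ => ∫ ω, ∏ i, φ i (V θ i ω) ∂P)
      (Set.Icc 0 (Real.pi / 2)) := by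
    refine monotoneOn_of_deriv_nonneg (convex_Icc _ _)
      (fun θ _ => (hderiv θ).2.continuousAt.continuousWithinAt)
      (fun θ _ => (hderiv θ).2.differentiableAt.differentiableWithinAt) fun θ hθ => ?_
    rw [interior_Icc] at hθ
    rw [(hderiv θ).2.deriv]
    exact hnonneg θ hθ
  have hpi := Real.pi_pos
  have := hmono (a := 0) (b := Real.pi / 2) ⟨le_rfl, by positivity⟩ ⟨by positivity, le_rfl⟩
    (by positivity)
  simpa [V] using this

end Slepian

/-! ### Slepian's inequality for orthant probabilities -/

section SlepianProbability

variable {ι : Type*} [Fintype ι]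

/-- Steep sigmoids approximate the indicator of the orthant, except on its boundary, where they stay
at `1/2`; `hne` discards that boundary. -/
lemma tendsto_integral_prod_sigmoid {Ω : Type*} {mΩ : MeasurableSpace Ω} {P : Measure Ω}
    [IsProbabilityMeasure P] {X : ι → Ω → ℝ} (hX : ∀ i, AEMeasurable (X i) P) (c : ι → ℝ)
    (hne : ∀ i, ∀ᵐ ω ∂P, X i ω ≠ c i) :
    Tendsto (fun n : ℕ => ∫ ω, ∏ i, Real.sigmoid (n * (c i - X i ω)) ∂P) atTop
      (𝓝 (P.real {ω | ∀ i, X i ω ≤ c i})) := by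
  classical
  have hs : NullMeasurableSet {ω | ∀ i, X i ω ≤ c i} P := by
    have : {ω | ∀ i, X i ω ≤ c i} = ⋂ i, {ω | X i ω ≤ c i} := by ext; simp
    rw [this]
    exact NullMeasurableSet.iInter fun i => nullMeasurableSet_le (hX i) aemeasurable_const
  have hP : P.real {ω | ∀ i, X i ω ≤ c i}
      = ∫ ω, Set.indicator {ω | ∀ i, X i ω ≤ c i} (fun _ => (1 : ℝ)) ω ∂P := by
    rw [integral_indicator₀ hs]; simp
  rw [hP]
  refine tendsto_integral_of_dominated_convergence (fun _ => (1 : ℝ)) (fun n => ?_)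
    (integrable_const _) (fun n => ae_of_all _ fun ω => ?_) ?_
  · refine AEMeasurable.aestronglyMeasurable (Finset.aemeasurable_fun_prod _ fun i _ => ?_)
    exact continuous_sigmoid.measurable.comp_aemeasurable
      ((aemeasurable_const.sub (hX i)).const_mul _)
  · rw [Real.norm_of_nonneg (Finset.prod_nonneg fun i _ => Real.sigmoid_nonneg _)]
    exact Finset.prod_le_one (fun i _ => Real.sigmoid_nonneg _) fun i _ => Real.sigmoid_le_one _
  · filter_upwards [ae_all_iff.2 hne] with ω hω
    have hlim : ∀ i, Tendsto (fun n : ℕ => Real.sigmoid (n * (c i - X i ω))) atTop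
        (𝓝 (if X i ω ≤ c i then 1 else 0)) := by
      intro i
      split_ifs with h
      · exact Real.tendsto_sigmoid_atTop.comp (tendsto_natCast_atTop_atTop.atTop_mul_const
          (sub_pos.2 (lt_of_le_of_ne h (hω i))))
      · exact Real.tendsto_sigmoid_atBot.comp (tendsto_natCast_atTop_atTop.atTop_mul_const_of_neg
          (sub_neg.2 (not_le.1 h)))
    have := tendsto_finsetProd Finset.univ fun i _ => hlim i
    convert this using 2
    simp [Set.indicator_apply, Finset.prod_ite_zero]

lemma _root_.ProbabilityTheory.HasGaussianLaw.ae_ne {Ω : Type*} {mΩ : MeasurableSpace Ω} {P : Measure Ω} {X : Ω → ℝ}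
    (hX : HasGaussianLaw X P) (hpos : 0 < cov[X, X; P]) (c : ℝ) : ∀ᵐ ω ∂P, X ω ≠ c := by
  have hmap := hX.map_eq_gaussianReal
  rw [covariance_self hX.aemeasurable] at hpos
  have := nullSingletonClass_gaussianReal (μ := P[X]) (v := Var[X; P].toNNReal)
    (by simpa using hpos)
  rw [← hmap] at this
  exact ae_of_ae_map hX.aemeasurable (Measure.ae_ne _ c)

/-- **Slepian's inequality** for two uncorrelated jointly Gaussian vectors. -/
lemma measureReal_forall_le_mono_of_prod {Ω : Type*} {mΩ : MeasurableSpace Ω} {P : Measure Ω}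
    {X Y : ι → Ω → ℝ}
    (hXY : HasGaussianLaw (fun ω => (fun i => X i ω, fun i => Y i ω)) P)
    (hind : ∀ i j, cov[X i, Y j; P] = 0)
    (hX0 : ∀ i, ∫ ω, X i ω ∂P = 0) (hY0 : ∀ i, ∫ ω, Y i ω ∂P = 0)
    (hpos : ∀ i, 0 < cov[Y i, Y i; P]) (hdiag : ∀ i, cov[Y i, Y i; P] = cov[X i, X i; P])
    (hle : ∀ i j, cov[Y i, Y j; P] ≤ cov[X i, X j; P]) (c : ι → ℝ) :
    P.real {ω | ∀ i, Y i ω ≤ c i} ≤ P.real {ω | ∀ i, X i ω ≤ c i} := by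
  have := hXY.isProbabilityMeasure
  have hX : ∀ i, HasGaussianLaw (X i) P := hXY.fst.eval
  have hY : ∀ i, HasGaussianLaw (Y i) P := hXY.snd.eval
  refine le_of_tendsto_of_tendsto'
    (tendsto_integral_prod_sigmoid (fun i => (hY i).aemeasurable) c
      fun i => (hY i).ae_ne (hpos i) _)
    (tendsto_integral_prod_sigmoid (fun i => (hX i).aemeasurable) c
      fun i => (hX i).ae_ne (hdiag i ▸ hpos i) _) fun n => ?_
  have hb : ∀ t, 0 ≤ Real.sigmoid t * (1 - Real.sigmoid t) ∧
      Real.sigmoid t * (1 - Real.sigmoid t) ≤ 1 := fun t => by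
    have h0 := Real.sigmoid_nonneg t
    have h1 := Real.sigmoid_le_one t
    constructor <;> nlinarith
  refine integral_prod_antitone_le hXY hind hX0 hY0 hpos hdiag hle (C := n)
    (φ := fun i x => Real.sigmoid (n * (c i - x)))
    (φ' := fun i x => Real.sigmoid (n * (c i - x)) * (1 - Real.sigmoid (n * (c i - x))) * (-n))
    ?_ (fun _ _ => Real.sigmoid_nonneg _) (fun _ _ => Real.sigmoid_le_one _) ?_ ?_ ?_
  · intro i x
    refine (Real.hasDerivAt_sigmoid _).comp x ?_
    simpa using ((hasDerivAt_id x).const_sub (c i)).const_mul (n : ℝ)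
  · intro i x
    exact mul_nonpos_of_nonneg_of_nonpos (hb _).1 (by simp)
  · intro i
    have : Continuous fun x => Real.sigmoid (n * (c i - x)) :=
      continuous_sigmoid.comp (by fun_prop)
    fun_prop
  · intro i x
    rw [abs_mul, abs_of_nonneg (hb _).1, abs_neg, Nat.abs_cast]
    exact mul_le_of_le_one_left (Nat.cast_nonneg n) (hb _).2

/-- **Slepian's inequality**: for centered Gaussian vectors with equal variances, the probability
of a lower orthant increases with the covariances. -/
theorem measureReal_forall_le_mono {Ω Ω' : Type*} {mΩ : MeasurableSpace Ω}
    {mΩ' : MeasurableSpace Ω'} {P : Measure Ω} {Q : Measure Ω'} {X : ι → Ω → ℝ} {Y : ι → Ω' → ℝ}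
    (hX : HasGaussianLaw (fun ω i => X i ω) P) (hY : HasGaussianLaw (fun ω i => Y i ω) Q)
    (hX0 : ∀ i, ∫ ω, X i ω ∂P = 0) (hY0 : ∀ i, ∫ ω, Y i ω ∂Q = 0)
    (hpos : ∀ i, 0 < cov[Y i, Y i; Q]) (hdiag : ∀ i, cov[Y i, Y i; Q] = cov[X i, X i; P])
    (hle : ∀ i j, cov[Y i, Y j; Q] ≤ cov[X i, X j; P]) (c : ι → ℝ) :
    Q.real {ω | ∀ i, Y i ω ≤ c i} ≤ P.real {ω | ∀ i, X i ω ≤ c i} := by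
  have := hX.isProbabilityMeasure
  have := hY.isProbabilityMeasure
  -- On the product space the two vectors become independent, hence jointly Gaussian and
  -- uncorrelated, with their laws unchanged.
  have hfst : (P.prod Q).map Prod.fst = P := by simp
  have hsnd : (P.prod Q).map Prod.snd = Q := by simp
  have hX' : HasGaussianLaw (fun (ω : Ω × Ω') i => X i ω.1) (P.prod Q) := by
    refine ⟨?_⟩
    have h := AEMeasurable.map_map_of_aemeasurable (μ := P.prod Q) (f := Prod.fst)
      (hfst.symm ▸ hX.aemeasurable) measurable_fst.aemeasurable
    rw [hfst] at h
    have := hX.isGaussian_map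
    rw [h] at this
    exact this
  have hY' : HasGaussianLaw (fun (ω : Ω × Ω') i => Y i ω.2) (P.prod Q) := by
    refine ⟨?_⟩
    have h := AEMeasurable.map_map_of_aemeasurable (μ := P.prod Q) (f := Prod.snd)
      (hsnd.symm ▸ hY.aemeasurable) measurable_snd.aemeasurable
    rw [hsnd] at h
    have := hY.isGaussian_map
    rw [h] at this
    exact this
  have hXm : ∀ i, AEMeasurable (X i) P := fun i => (hX.eval i).aemeasurable
  have hYm : ∀ i, AEMeasurable (Y i) Q := fun i => (hY.eval i).aemeasurable
  have hind : IndepFun (fun (ω : Ω × Ω') i => X i ω.1) (fun ω i => Y i ω.2) (P.prod Q) :=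
    indepFun_prod₀ hX.aemeasurable hY.aemeasurable
  have hXX : ∀ i j, cov[fun ω : Ω × Ω' => X i ω.1, fun ω => X j ω.1; P.prod Q]
      = cov[X i, X j; P] := fun i j => by
    conv_rhs => rw [← hfst]
    rw [covariance_map_fun (by rw [hfst]; exact (hXm i).aestronglyMeasurable)
      (by rw [hfst]; exact (hXm j).aestronglyMeasurable) measurable_fst.aemeasurable]
  have hYY : ∀ i j, cov[fun ω : Ω × Ω' => Y i ω.2, fun ω => Y j ω.2; P.prod Q]
      = cov[Y i, Y j; Q] := fun i j => by
    conv_rhs => rw [← hsnd]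
    rw [covariance_map_fun (by rw [hsnd]; exact (hYm i).aestronglyMeasurable)
      (by rw [hsnd]; exact (hYm j).aestronglyMeasurable) measurable_snd.aemeasurable]
  have key := measureReal_forall_le_mono_of_prod (P := P.prod Q) (X := fun i ω => X i ω.1)
    (Y := fun i ω => Y i ω.2) (hind.hasGaussianLaw hX' hY') ?_ ?_ ?_ ?_ ?_ ?_ c
  · have e1 : {ω : Ω × Ω' | ∀ i, X i ω.1 ≤ c i} = {ω | ∀ i, X i ω ≤ c i} ×ˢ Set.univ := by
      ext; simp
    have e2 : {ω : Ω × Ω' | ∀ i, Y i ω.2 ≤ c i} = Set.univ ×ˢ {ω | ∀ i, Y i ω ≤ c i} := by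
      ext; simp
    rwa [e1, e2, measureReal_prod_prod, measureReal_prod_prod, probReal_univ, probReal_univ,
      one_mul, mul_one] at key
  · intro i j
    have hi := hind.comp (measurable_pi_apply i) (measurable_pi_apply j)
    exact hi.covariance_eq_zero (hX'.eval i).memLp_two (hY'.eval j).memLp_two
  · intro i
    rw [integral_fun_fst]; simp [hX0]
  · intro i
    rw [integral_fun_snd]; simp [hY0]
  · intro i; rw [hYY]; exact hpos i
  · intro i; rw [hYY, hXX]; exact hdiag i
  · intro i j; rw [hYY, hXX]; exact hle i j

end SlepianProbability

/-! ### Standard normal distribution function, quantiles and tails -/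

section NormalTail

lemma continuous_cdf_gaussianReal : Continuous (cdf (gaussianReal 0 1)) := by
  have hns := nullSingletonClass_gaussianReal (μ := 0) (v := 1) one_ne_zero
  refine continuous_iff_continuousAt.2 fun x => continuousAt_iff_continuous_left'_right'.2
    ⟨?_, ((cdf (gaussianReal 0 1)).right_continuous x).mono Set.Ioi_subset_Ici_self⟩
  rw [(monotone_cdf _).continuousWithinAt_Iio_iff_leftLim_eq]
  have h := (cdf (gaussianReal 0 1)).measure_singleton x
  rw [measure_cdf, measure_singleton] at h
  have h1 := ENNReal.ofReal_eq_zero.1 h.symm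
  exact le_antisymm ((monotone_cdf _).leftLim_le le_rfl) (by linarith)

lemma one_sub_cdf_eq (x : ℝ) :
    1 - cdf (gaussianReal 0 1) x = ∫ u in Set.Ioi x, gaussianPDFReal 0 1 u := by
  rw [cdf_eq_real, ← probReal_compl_eq_one_sub measurableSet_Iic, Set.compl_Iic, measureReal_def,
    gaussianReal_apply_eq_integral _ one_ne_zero, ENNReal.toReal_ofReal]
  exact integral_nonneg fun _ => gaussianPDFReal_nonneg _ _ _

lemma cdf_gaussianReal_lt_one (x : ℝ) : cdf (gaussianReal 0 1) x < 1 := by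
  have h : 0 < ∫ u in Set.Ioi x, gaussianPDFReal 0 1 u := by
    rw [setIntegral_pos_iff_support_of_nonneg_ae
      (ae_of_all _ fun _ => gaussianPDFReal_nonneg _ _ _)
      (integrable_gaussianPDFReal _ _).integrableOn]
    have : Function.support (gaussianPDFReal 0 1) = Set.univ := by
      ext u; simpa using (gaussianPDFReal_pos 0 1 u one_ne_zero).ne'
    simp [this]
  have := one_sub_cdf_eq x
  linarith

lemma cdf_gaussianReal_neg (x : ℝ) :
    cdf (gaussianReal 0 1) (-x) = 1 - cdf (gaussianReal 0 1) x := by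
  have hns := nullSingletonClass_gaussianReal (μ := 0) (v := 1) one_ne_zero
  have hmap : (gaussianReal 0 1).map (fun x => -x) = gaussianReal 0 1 := by
    simpa using gaussianReal_map_neg (μ := 0) (v := 1)
  rw [cdf_eq_real, cdf_eq_real, ← probReal_compl_eq_one_sub measurableSet_Iic, Set.compl_Iic]
  conv_lhs => rw [← hmap]
  rw [map_measureReal_apply measurable_neg measurableSet_Iic]
  have : (fun x : ℝ => -x) ⁻¹' Set.Iic (-x) = Set.Ici x := by ext; simp
  rw [this]
  exact measureReal_congr Ioi_ae_eq_Ici.symm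

/-- Pointwise on the densities: the density at `u + δ` is `exp (-u δ - δ² / 2)` times the density at
`u`, and `u > x`. -/
lemma one_sub_cdf_add_le (x : ℝ) {δ : ℝ} (hδ : 0 ≤ δ) :
    1 - cdf (gaussianReal 0 1) (x + δ)
      ≤ Real.exp (-(x * δ)) * (1 - cdf (gaussianReal 0 1) x) := by
  rw [one_sub_cdf_eq, one_sub_cdf_eq, ← integral_const_mul,
    ← (measurePreserving_add_right volume δ).setIntegral_preimage_emb
      (measurableEmbedding_addRight δ) _ (Set.Ioi (x + δ))]
  have hpre : (fun u => u + δ) ⁻¹' Set.Ioi (x + δ) = Set.Ioi x := by ext; simp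
  rw [hpre]
  refine setIntegral_mono_on ?_ ((integrable_gaussianPDFReal _ _).integrableOn.const_mul _)
    measurableSet_Ioi fun u hu => ?_
  · exact ((integrable_gaussianPDFReal 0 1).comp_add_right δ).integrableOn
  · have hu' : x < u := hu
    simp only [gaussianPDFReal]
    rw [mul_left_comm, ← Real.exp_add]
    refine mul_le_mul_of_nonneg_left (Real.exp_le_exp.2 ?_) (by positivity)
    simp only [NNReal.coe_one]
    nlinarith [mul_nonneg hδ (sub_nonneg.2 hu'.le), sq_nonneg δ]

/-- Continuity makes the set closed, and the limits of the distribution function at `±∞` make it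
nonempty and bounded below, so the infimum is attained. -/
lemma isLeast_stdNormalQuantile {p : ℝ} (hp : p ∈ Set.Ioo (0 : ℝ) 1) :
    IsLeast {x : ℝ | p ≤ cdf (gaussianReal 0 1) x} (stdNormalQuantile p) := by
  have hcl : IsClosed {x : ℝ | p ≤ cdf (gaussianReal 0 1) x} :=
    isClosed_le continuous_const continuous_cdf_gaussianReal
  have hne : {x : ℝ | p ≤ cdf (gaussianReal 0 1) x}.Nonempty := by
    obtain ⟨x, hx⟩ := ((tendsto_cdf_atTop (gaussianReal 0 1)).eventually (lt_mem_nhds hp.2)).exists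
    exact ⟨x, hx.le⟩
  have hbdd : BddBelow {x : ℝ | p ≤ cdf (gaussianReal 0 1) x} := by
    obtain ⟨x, hx⟩ := ((tendsto_cdf_atBot (gaussianReal 0 1)).eventually (gt_mem_nhds hp.1)).exists
    refine ⟨x, fun y hy => le_of_not_gt fun hyx => ?_⟩
    exact absurd (hy.trans (monotone_cdf _ hyx.le)) (not_le.2 hx)
  exact ⟨hcl.csInf_mem hne hbdd, fun y hy => csInf_le hbdd hy⟩

lemma cdf_stdNormalQuantile {p : ℝ} (hp : p ∈ Set.Ioo (0 : ℝ) 1) :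
    cdf (gaussianReal 0 1) (stdNormalQuantile p) = p := by
  have h := isLeast_stdNormalQuantile hp
  refine le_antisymm ?_ h.1
  have ht : Tendsto (cdf (gaussianReal 0 1)) (𝓝[<] stdNormalQuantile p)
      (𝓝 (cdf (gaussianReal 0 1) (stdNormalQuantile p))) :=
    continuous_cdf_gaussianReal.continuousAt.tendsto.mono_left nhdsWithin_le_nhds
  refine le_of_tendsto ht ?_
  filter_upwards [self_mem_nhdsWithin] with x hx
  exact le_of_not_ge fun hpx => absurd (h.2 hpx) (not_le.2 hx)

lemma one_sub_inv_mem_Ioo {k : ℕ} (hk : 2 ≤ k) : 1 - 1 / (k : ℝ) ∈ Set.Ioo (0 : ℝ) 1 := by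
  have h2 : (2 : ℝ) ≤ k := by exact_mod_cast hk
  have : 1 / (k : ℝ) < 1 := by rw [div_lt_one] <;> linarith
  have : 0 < 1 / (k : ℝ) := by positivity
  constructor <;> linarith

lemma tendsto_stdNormalQuantile_atTop :
    Tendsto (fun k : ℕ => stdNormalQuantile (1 - 1 / (k : ℝ))) atTop atTop := by
  refine tendsto_atTop.2 fun M => ?_
  have hlim : Tendsto (fun k : ℕ => 1 - 1 / (k : ℝ)) atTop (𝓝 1) := by
    simpa using (tendsto_const_div_atTop_nhds_zero_nat (1 : ℝ)).const_sub 1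
  filter_upwards [hlim.eventually (lt_mem_nhds (cdf_gaussianReal_lt_one M)),
    eventually_ge_atTop 2] with k hk hk2
  refine le_of_not_gt fun hlt => ?_
  have h1 := (isLeast_stdNormalQuantile (one_sub_inv_mem_Ioo hk2)).1
  exact absurd (h1.trans (monotone_cdf _ hlt.le)) (not_le.2 hk)

/-- Shifting the `1 - 1/k` quantile by a positive constant makes the expected number of exceedances
among `k` standard normal variables negligible. -/
lemma tendsto_mul_one_sub_cdf_quantile_add {δ : ℝ} (hδ : 0 < δ) :
    Tendsto (fun k : ℕ => (k : ℝ) *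
      (1 - cdf (gaussianReal 0 1) (stdNormalQuantile (1 - 1 / (k : ℝ)) + δ))) atTop (𝓝 0) := by
  have hexp : Tendsto (fun k : ℕ => Real.exp (-(stdNormalQuantile (1 - 1 / (k : ℝ)) * δ)))
      atTop (𝓝 0) :=
    Real.tendsto_exp_neg_atTop_nhds_zero.comp (tendsto_stdNormalQuantile_atTop.atTop_mul_const hδ)
  refine squeeze_zero' (Eventually.of_forall fun k => ?_) ?_ hexp
  · exact mul_nonneg (Nat.cast_nonneg k) (sub_nonneg.2 (cdf_le_one _ _))
  -- For `k = 1` the level `1 - 1 / k` is `0`, which has no quantile; hence `k ≥ 2`.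
  · filter_upwards [eventually_ge_atTop 2] with k hk
    have hk0 : (0 : ℝ) < k := by exact_mod_cast (by omega : 0 < k)
    have h := one_sub_cdf_add_le (stdNormalQuantile (1 - 1 / (k : ℝ))) hδ.le
    rw [cdf_stdNormalQuantile (one_sub_inv_mem_Ioo hk), sub_sub_cancel] at h
    calc _ ≤ (k : ℝ) * (_ * (1 / (k : ℝ))) := mul_le_mul_of_nonneg_left h hk0.le
      _ = _ := by field_simp

end NormalTail

/-! ### The comparison vector with independent blocks -/

section FactorModel

variable {κ ι : Type*} [Fintype κ] [Fintype ι]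

/-- The law of independent standard normal factors, one for each block and one for each index. -/
noncomputable def factorLaw (κ ι : Type*) [Fintype κ] [Fintype ι] : Measure (κ ⊕ ι → ℝ) :=
  Measure.pi fun _ => gaussianReal 0 1

instance : IsProbabilityMeasure (factorLaw κ ι) := by
  unfold factorLaw; infer_instance

/-- The block equicorrelated vector `√ρ Z_{b i} + √(1 - ρ) Z_i`, independent across blocks. -/
noncomputable def factorVector (b : ι → κ) (ρ : κ → ℝ) (i : ι) (z : κ ⊕ ι → ℝ) : ℝ :=
  √(ρ (b i)) * z (.inl (b i)) + √(1 - ρ (b i)) * z (.inr i)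

lemma map_factor (k : κ ⊕ ι) :
    (factorLaw κ ι).map (fun z => z k) = gaussianReal 0 1 :=
  (measurePreserving_eval (fun _ : κ ⊕ ι => gaussianReal 0 1) k).map_eq

lemma hasGaussianLaw_factor (k : κ ⊕ ι) :
    HasGaussianLaw (fun z : κ ⊕ ι → ℝ => z k) (factorLaw κ ι) := by
  refine ⟨?_⟩
  rw [map_factor]
  infer_instance

lemma iIndepFun_factor :
    iIndepFun (fun (k : κ ⊕ ι) (z : κ ⊕ ι → ℝ) => z k) (factorLaw κ ι) :=
  iIndepFun_pi (μ := fun _ : κ ⊕ ι => gaussianReal 0 1) (X := fun _ x => x)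
    fun _ => aemeasurable_id

lemma integral_factor (k : κ ⊕ ι) : ∫ z, z k ∂(factorLaw κ ι) = 0 := by
  have h := integral_map (μ := factorLaw κ ι) (φ := fun z : κ ⊕ ι → ℝ => z k) (f := fun x => x)
    (measurable_pi_apply k).aemeasurable aestronglyMeasurable_id
  rw [← h, map_factor]
  simp

lemma covariance_factor [DecidableEq (κ ⊕ ι)] (k l : κ ⊕ ι) :
    cov[fun z => z k, fun z => z l; factorLaw κ ι] = if k = l then 1 else 0 := by
  split_ifs with h
  · subst h
    have h := variance_map (μ := factorLaw κ ι) (X := id) (Y := fun z : κ ⊕ ι → ℝ => z k)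
      (by fun_prop) (measurable_pi_apply k).aemeasurable
    rw [map_factor, variance_id_gaussianReal] at h
    rw [covariance_self (measurable_pi_apply k).aemeasurable]
    simpa using h.symm
  · exact (iIndepFun_factor.indepFun h).covariance_eq_zero (hasGaussianLaw_factor k).memLp_two
      (hasGaussianLaw_factor l).memLp_two

lemma hasGaussianLaw_factorVector (b : ι → κ) (ρ : κ → ℝ) :
    HasGaussianLaw (fun z i => factorVector b ρ i z) (factorLaw κ ι) := by
  have h : HasGaussianLaw (fun z : κ ⊕ ι → ℝ => z) (factorLaw κ ι) :=
    iIndepFun_factor.hasGaussianLaw hasGaussianLaw_factor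
  let pr : κ ⊕ ι → (κ ⊕ ι → ℝ) →L[ℝ] ℝ := fun k => ContinuousLinearMap.proj k
  let L : (κ ⊕ ι → ℝ) →L[ℝ] ι → ℝ := ContinuousLinearMap.pi fun i =>
    √(ρ (b i)) • pr (.inl (b i)) + √(1 - ρ (b i)) • pr (.inr i)
  exact h.map_fun L

lemma integral_factorVector (b : ι → κ) (ρ : κ → ℝ) (i : ι) :
    ∫ z, factorVector b ρ i z ∂(factorLaw κ ι) = 0 := by
  simp only [factorVector]
  rw [integral_add ((hasGaussianLaw_factor _).integrable.const_mul _)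
    ((hasGaussianLaw_factor _).integrable.const_mul _), integral_const_mul, integral_const_mul,
    integral_factor, integral_factor]
  simp

lemma covariance_factorVector [DecidableEq κ] [DecidableEq ι] (b : ι → κ) {ρ : κ → ℝ}
    (hρ : ∀ k, ρ k ∈ Set.Ioo (0 : ℝ) 1) (i j : ι) :
    cov[factorVector b ρ i, factorVector b ρ j; factorLaw κ ι]
      = if i = j then 1 else if b i = b j then ρ (b i) else 0 := by
  have m1 : ∀ i, MemLp (fun z : κ ⊕ ι → ℝ => √(ρ (b i)) * z (.inl (b i))) 2 (factorLaw κ ι) :=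
    fun i => (hasGaussianLaw_factor _).memLp_two.const_mul _
  have m2 : ∀ i, MemLp (fun z : κ ⊕ ι → ℝ => √(1 - ρ (b i)) * z (.inr i)) 2 (factorLaw κ ι) :=
    fun i => (hasGaussianLaw_factor _).memLp_two.const_mul _
  have e : ∀ i, factorVector b ρ i = (fun z : κ ⊕ ι → ℝ => √(ρ (b i)) * z (.inl (b i)))
      + fun z => √(1 - ρ (b i)) * z (.inr i) := fun _ => rfl
  rw [e, e, covariance_add_left (m1 i) (m2 i) ((m1 j).add (m2 j)),
    covariance_add_right (m1 i) (m1 j) (m2 j), covariance_add_right (m2 i) (m1 j) (m2 j)]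
  simp only [covariance_const_mul_left, covariance_const_mul_right, covariance_factor,
    Sum.inl.injEq, Sum.inr.injEq, reduceCtorEq, if_false]
  have hs1 := Real.mul_self_sqrt (hρ (b i)).1.le
  have hs2 := Real.mul_self_sqrt (sub_nonneg.2 (hρ (b i)).2.le)
  by_cases hij : i = j
  · subst hij
    simp only [if_true]
    linarith
  · by_cases hb : b i = b j
    · simp only [hij, ← hb, if_true, if_false]
      linarith
    · simp [hij, hb]

/-- The loadings are nonnegative, so the orthant contains a box in the independent factors, whose
probability factorizes. -/
lemma prod_cdf_le_measureReal_factorVector (b : ι → κ) (ρ : κ → ℝ) (c : ι → ℝ) (s : κ → ℝ)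
    (t : ι → ℝ) (h : ∀ i, √(ρ (b i)) * s (b i) + √(1 - ρ (b i)) * t i ≤ c i) :
    (∏ k, cdf (gaussianReal 0 1) (s k)) * ∏ i, cdf (gaussianReal 0 1) (t i)
      ≤ (factorLaw κ ι).real {z | ∀ i, factorVector b ρ i z ≤ c i} := by
  have hbox : (factorLaw κ ι).real (Set.univ.pi fun k => Set.Iic (Sum.elim s t k))
      = (∏ k, cdf (gaussianReal 0 1) (s k)) * ∏ i, cdf (gaussianReal 0 1) (t i) := by
    rw [measureReal_def, factorLaw, Measure.pi_pi, ENNReal.toReal_prod, Fintype.prod_sum_type]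
    simp [cdf_eq_real, measureReal_def]
  rw [← hbox]
  refine measureReal_mono fun z hz i => ?_
  have h1 : z (.inl (b i)) ≤ s (b i) := hz (.inl (b i)) trivial
  have h2 : z (.inr i) ≤ t i := hz (.inr i) trivial
  refine le_trans ?_ (h i)
  exact add_le_add (mul_le_mul_of_nonneg_left h1 (Real.sqrt_nonneg _))
    (mul_le_mul_of_nonneg_left h2 (Real.sqrt_nonneg _))

end FactorModel

/-- The union bound for independent events, proved as Weierstrass' product inequality. -/
lemma one_sub_sum_le_prod {ι : Type*} (s : Finset ι) {x : ι → ℝ} (h0 : ∀ i, 0 ≤ x i)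
    (h1 : ∀ i, x i ≤ 1) : 1 - ∑ i ∈ s, (1 - x i) ≤ ∏ i ∈ s, x i := by
  classical
  induction s using Finset.induction_on with
  | empty => simp
  | insert a s ha ih =>
    rw [Finset.sum_insert ha, Finset.prod_insert ha]
    have hp : ∏ i ∈ s, x i ≤ 1 := Finset.prod_le_one (fun i _ => h0 i) fun i _ => h1 i
    nlinarith [h0 a, h1 a]

/-! ### Error rate at fixed sample size -/

section Procedure

variable {n m : ℕ}

/-- Bound on the family-wise error rate through a box in the factor model: by Slepian's inequality,
no true null is rejected with at least the probability that all block factors stay below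
`-Φ⁻¹(β) - ε` and all individual factors stay below a slightly raised quantile. -/
lemma fwer_le {Ω : Type*} [MeasurableSpace Ω] {P : Measure Ω} [IsProbabilityMeasure P]
    {ρ : Fin m → ℝ} (hρ : ∀ j, ρ j ∈ Set.Ioo (0 : ℝ) 1) {b : Fin n → Fin m}
    {R : Matrix (Fin n) (Fin n) ℝ} (hR : IsBlockCorrelation b ρ R) {μ : Fin n → ℝ}
    {X : Fin n → Ω → ℝ} (hX : IsGaussianVector P X μ R) (α ε : ℝ) :
    fwer P X μ (blockProcedure α b ρ) ≤
      1 - cdf (gaussianReal 0 1) (-stdNormalQuantile (1 - (1 - α) ^ (1 / (m : ℝ))) - ε) ^ m *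
        (1 - ∑ j, (blockSize b j : ℝ) * (1 - cdf (gaussianReal 0 1)
          (stdNormalQuantile (1 - 1 / (blockSize b j : ℝ)) + √(ρ j) * ε / √(1 - ρ j)))) := by
  classical
  set q := stdNormalQuantile (1 - (1 - α) ^ (1 / (m : ℝ))) with hq
  set t : Fin m → ℝ := fun j =>
    stdNormalQuantile (1 - 1 / (blockSize b j : ℝ)) + √(ρ j) * ε / √(1 - ρ j) with ht
  set c : Fin n → ℝ := fun i =>
    cutoff (blockSize b (b i)) (ρ (b i)) (1 - (1 - α) ^ (1 / (m : ℝ))) with hc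
  let ι := {i : Fin n // μ i = 0}
  let b' : ι → Fin m := fun i => b i
  have hXi : ∀ i, HasGaussianLaw (X i) P := fun i => hX.gaussian.eval i
  have hG : HasGaussianLaw (fun ω (i : ι) => X i ω) P :=
    hX.gaussian.map_fun (ContinuousLinearMap.pi fun i : ι =>
      ContinuousLinearMap.proj (R := ℝ) (φ := fun _ : Fin n => ℝ) (i : Fin n))
  -- Slepian needs centered vectors, hence the restriction to true nulls. Variances and within-block
  -- covariances agree; between blocks `0` is compared with a nonnegative entry.
  have hslep := measureReal_forall_le_mono (P := P) (Q := factorLaw (Fin m) ι)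
    (X := fun i : ι => X i) (Y := factorVector b' ρ) hG (hasGaussianLaw_factorVector b' ρ)
    (fun i => (hX.mean i).trans i.2) (integral_factorVector b' ρ)
    (fun i => by rw [covariance_factorVector b' hρ]; simp)
    (fun i => by rw [covariance_factorVector b' hρ, hX.covariance, hR.diag]; simp)
    (fun i j => by
      rw [covariance_factorVector b' hρ, hX.covariance]
      split_ifs with hij hb
      · rw [hij, hR.diag]
      · rw [hR.within _ _ (fun h => hij (Subtype.ext h)) hb]
      · exact hR.between _ _ hb)
    fun i => c i
  -- The shift in `t` is chosen so that the corner of the box meets the cutoff with equality: the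
  -- two `√ρ ε` terms cancel.
  have hbox := prod_cdf_le_measureReal_factorVector b' ρ (fun i => c i) (fun _ => -q - ε)
    (fun i => t (b' i)) fun i => by
      have h1 : 0 < √(1 - ρ (b i)) := Real.sqrt_pos.2 (sub_pos.2 (hρ _).2)
      simp only [hc, ht, b', cutoff, ← hq]
      apply le_of_eq
      field_simp
      ring
  have hnull : NullMeasurableSet {ω | ∀ i : ι, X i ω ≤ c i} P := by
    have : {ω | ∀ i : ι, X i ω ≤ c i} = ⋂ i : ι, {ω | X i ω ≤ c i} := by ext; simp
    rw [this]
    exact NullMeasurableSet.iInter fun i =>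
      nullMeasurableSet_le (hXi i).aemeasurable aemeasurable_const
  have hfwer : fwer P X μ (blockProcedure α b ρ) = 1 - P.real {ω | ∀ i : ι, X i ω ≤ c i} := by
    have hset : {ω | 1 ≤ falseRejections (blockProcedure α b ρ) μ (fun i => X i ω)}
        = {ω | ∀ i : ι, X i ω ≤ c i}ᶜ := by
      ext ω
      simp only [falseRejections, blockProcedure, trueNulls, Set.mem_ofPred_eq, Set.mem_compl_iff,
        Nat.one_le_iff_ne_zero, Finset.card_ne_zero, not_forall, not_le]
      constructor
      · rintro ⟨i, hi⟩
        simp only [Finset.mem_inter, Finset.mem_filter, Finset.mem_univ, true_and] at hi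
        exact ⟨⟨i, hi.2⟩, hi.1⟩
      · rintro ⟨i, hi⟩
        exact ⟨i, Finset.mem_inter.2 ⟨Finset.mem_filter.2 ⟨Finset.mem_univ _, hi⟩,
          Finset.mem_filter.2 ⟨Finset.mem_univ _, i.2⟩⟩⟩
    rw [fwer, hset, measureReal_compl₀ hnull, probReal_univ]
  -- Enlarging the sum from true nulls to whole blocks is harmless, since even the full sum vanishes
  -- in the limit.
  have hsum : ∑ i : ι, (1 - cdf (gaussianReal 0 1) (t (b' i)))
      ≤ ∑ j, (blockSize b j : ℝ) * (1 - cdf (gaussianReal 0 1) (t j)) := by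
    have h1 : ∑ i : ι, (1 - cdf (gaussianReal 0 1) (t (b' i)))
        ≤ ∑ i : Fin n, (1 - cdf (gaussianReal 0 1) (t (b i))) := by
      rw [← Finset.sum_subtype (Finset.univ.filter fun i => μ i = 0) (by simp)
        (fun i => 1 - cdf (gaussianReal 0 1) (t (b i)))]
      exact Finset.sum_le_sum_of_subset_of_nonneg (Finset.subset_univ _)
        fun i _ _ => sub_nonneg.2 (cdf_le_one _ _)
    refine h1.trans (le_of_eq ?_)
    rw [← Finset.sum_fiberwise Finset.univ b]
    refine Finset.sum_congr rfl fun j _ => ?_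
    rw [Finset.sum_congr rfl fun i hi => by rw [(Finset.mem_filter.1 hi).2], Finset.sum_const,
      nsmul_eq_mul]
    rfl
  have hprod := one_sub_sum_le_prod Finset.univ
    (x := fun i : ι => cdf (gaussianReal 0 1) (t (b' i))) (fun i => cdf_nonneg _ _)
    fun i => cdf_le_one _ _
  rw [Finset.prod_const, Finset.card_univ, Fintype.card_fin] at hbox
  have hpow : 0 ≤ cdf (gaussianReal 0 1) (-q - ε) ^ m := pow_nonneg (cdf_nonneg _ _) m
  have := mul_le_mul_of_nonneg_left ((sub_le_sub_left hsum 1).trans hprod) hpow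
  rw [hfwer]
  linarith

end Procedure

end BlockFWER

/-! ### Passage to the limit in `n`, then in `ε` -/

theorem corollary5p1
    {m : ℕ} (hm : 0 < m)
    (α : ℝ) (hα : α ∈ Set.Ioo (0 : ℝ) 1)
    (ρ : Fin m → ℝ) (hρ : ∀ j, ρ j ∈ Set.Ioo (0 : ℝ) 1)
    (b : ∀ n : ℕ, Fin n → Fin m)
    (R : ∀ n : ℕ, Matrix (Fin n) (Fin n) ℝ)
    (hR : ∀ n, BlockFWER.IsBlockCorrelation (b n) ρ (R n))
    (μ : ∀ n : ℕ, Fin n → ℝ) (hμ : ∀ n i, 0 ≤ μ n i)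
    {Ω : ℕ → Type*} [∀ n, MeasurableSpace (Ω n)]
    (P : ∀ n, Measure (Ω n)) [∀ n, IsProbabilityMeasure (P n)]
    (X : ∀ n : ℕ, Fin n → Ω n → ℝ)
    (hX : ∀ n, BlockFWER.IsGaussianVector (P n) (X n) (μ n) (R n))
    (hk : Tendsto (fun n => ⨅ j, BlockFWER.blockSize (b n) j) atTop atTop)
    (p : Fin m → ℝ) (hp : ∀ j, 0 < p j)
    (hnull : ∀ j, Tendsto
      (fun n => (BlockFWER.blockNullSize (b n) (μ n) j : ℝ) / (BlockFWER.blockSize (b n) j : ℝ))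
      atTop (𝓝 (p j))) :
    limsup (fun n => BlockFWER.fwer (P n) (X n) (μ n) (BlockFWER.blockProcedure α (b n) ρ))
      atTop ≤ α := by
  have hm' : (m : ℝ) ≠ 0 := by exact_mod_cast hm.ne'
  have hβ1 : (1 - α) ^ (1 / (m : ℝ)) ∈ Set.Ioo (0 : ℝ) 1 :=
    ⟨Real.rpow_pos_of_pos (by linarith [hα.2]) _,
      Real.rpow_lt_one (by linarith [hα.2]) (by linarith [hα.1]) (by positivity)⟩
  have hβ : 1 - (1 - α) ^ (1 / (m : ℝ)) ∈ Set.Ioo (0 : ℝ) 1 :=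
    ⟨by linarith [hβ1.2], by linarith [hβ1.1]⟩
  set q := BlockFWER.stdNormalQuantile (1 - (1 - α) ^ (1 / (m : ℝ))) with hq
  have hkj : ∀ j, Tendsto (fun n => BlockFWER.blockSize (b n) j) atTop atTop := fun j =>
    tendsto_atTop_mono (fun n => ciInf_le (OrderBot.bddBelow _) j) hk
  have hlimsup : ∀ ε > 0,
      limsup (fun n => BlockFWER.fwer (P n) (X n) (μ n) (BlockFWER.blockProcedure α (b n) ρ)) atTop
        ≤ 1 - cdf (gaussianReal 0 1) (-q - ε) ^ m := by
    intro ε hε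
    have hterm : ∀ j, Tendsto (fun n => (BlockFWER.blockSize (b n) j : ℝ) *
        (1 - cdf (gaussianReal 0 1)
          (BlockFWER.stdNormalQuantile (1 - 1 / (BlockFWER.blockSize (b n) j : ℝ))
            + √(ρ j) * ε / √(1 - ρ j)))) atTop (𝓝 0) := by
      intro j
      have h1 : 0 < √(ρ j) := Real.sqrt_pos.2 (hρ j).1
      have h2 : 0 < √(1 - ρ j) := Real.sqrt_pos.2 (sub_pos.2 (hρ j).2)
      -- Positive correlation is what makes the shift strictly positive.
      exact (BlockFWER.tendsto_mul_one_sub_cdf_quantile_add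
        (div_pos (mul_pos h1 hε) h2)).comp (hkj j)
    have hbound := (((tendsto_finsetSum Finset.univ fun j _ => hterm j).const_sub 1).const_mul
      (cdf (gaussianReal 0 1) (-q - ε) ^ m)).const_sub 1
    rw [Finset.sum_const_zero, sub_zero, mul_one] at hbound
    rw [← hbound.limsup_eq]
    refine limsup_le_limsup
      (Eventually.of_forall fun n => BlockFWER.fwer_le hρ (hR n) (hX n) α ε) ?_
      hbound.isBoundedUnder_le
    exact (isBoundedUnder_of ⟨0, fun n => measureReal_nonneg⟩ :
      IsBoundedUnder (· ≥ ·) atTop _).isCoboundedUnder_le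
  have hcont : Tendsto (fun ε : ℝ => 1 - cdf (gaussianReal 0 1) (-q - ε) ^ m) (𝓝[>] 0)
      (𝓝 (1 - cdf (gaussianReal 0 1) (-q - 0) ^ m)) := by
    have : Continuous fun ε : ℝ => 1 - cdf (gaussianReal 0 1) (-q - ε) ^ m :=
      continuous_const.sub ((BlockFWER.continuous_cdf_gaussianReal.comp (by fun_prop)).pow m)
    exact (this.tendsto 0).mono_left nhdsWithin_le_nhds
  -- By symmetry `Φ(-q) = 1 - β = (1 - α)^(1/m)`, whose `m`-th power is `1 - α`.
  have hval : 1 - cdf (gaussianReal 0 1) (-q - 0) ^ m = α := by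
    rw [sub_zero, BlockFWER.cdf_gaussianReal_neg, hq, BlockFWER.cdf_stdNormalQuantile hβ,
      sub_sub_cancel, one_div, Real.rpow_inv_natCast_pow (by linarith [hα.2]) hm.ne']
    ring
  rw [hval] at hcont
  refine ge_of_tendsto hcont ?_
  filter_upwards [self_mem_nhdsWithin] with ε hε using hlimsup ε hε
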